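/- Let $X$, $Y$ be Banach spaces, let $p,q\in[1,+\infty)$ be real numbers and let $f:\mathbb R\times X\to Y$ be a map. Functions that are equal almost everywhere are identified. For $u\in L^p_{loc}(\mathbb R,X)$ (that is, $u\in L^p(a,b;X)$ in the sense of Bochner for every bounded interval $(a,b)$), let $u^b:\mathbb R\to L^p(0,1;X)$, $u^b(t)(\theta)=u(t+\theta)$, be its Bochner transform, and let $$BS^p(\mathbb R,X)=\{u\in L^p_{loc}(\mathbb R,X): u^b \text{ is bounded and continuous}\},\qquad \|u\|_{S^p}=\sup_{t\in\mathbb R}\Big(\int_0^1\|u(t+\theta)\|^p\,d\theta\Big)^{1/p}.$$ A continuous function $U:\mathbb R\to E$ into a Banach space $E$ is called almost automorphic if every real sequence has a subsequence $(t_k)_k$ for which there is a function $V:\mathbb R\to E$ such that, for all $t\in\mathbb R$, $\lim_{k}U(t+t_k)=V(t)$ and $\lim_{k}V(t-t_k)=U(t)$. Let $S^p_{aa}(\mathbb R,X)$ be the set of all $u\in L^p_{loc}(\mathbb R,X)$ such that $u^b$ is almost automorphic, and let $L^p_1(\mathbb R,X)$ be the set of all $u\in L^p_{loc}(\mathbb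 R,X)$ such that $u(t+1)=u(t)$ for almost every $t\in\mathbb R$. Then $L^p_1(\mathbb R,X)\subset S^p_{aa}(\mathbb R,X)\subset BS^p(\mathbb R,X)$, and all these spaces carry the norm $\|\cdot\|_{S^p}$ (similarly for $q$ and $Y$, with $\|\cdot\|_{S^q}$). Put $\mathcal N_f(u)(t)=f(t,u(t))$. Theorem. The following assertions are equivalent. (i) The Nemytskii operator $\mathcal N_f$ maps $S^p_{aa}(\mathbb R,X)$ into $S^q_{aa}(\mathbb R,Y)$ and $\mathcal N_f:S^p_{aa}(\mathbb R,X)\to S^q_{aa}(\mathbb R,Y)$ is continuous. (ii) The operator $G:L^p_1(\mathbb R,X)\to S^q_{aa}(\mathbb R,Y)$, $G(u)=\mathcal N_f(u)$, is well-defined and continuous. (iii) For all $x\in X$, $f(\cdot,x)\in S^q_{aa}(\mathbb R,Y)$, and the operator $H:L^p_1(\mathbb R,X)\to BS^q(\mathbb R,Y)$, $H(u)=\mathcal N_f(u)$, is well-defined and continuous. -/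

import Mathlib

open MeasureTheory Set Filter Topology
open scoped ENNReal

namespace Stepanov

/-- Almost automorphic functions `ℝ → E` (Bochner's definition, with pointwise limits):
`u` is continuous and every real sequence `s` has a subsequence `s ∘ φ` and a function `v` with
`u (t + s (φ k)) → v t` and `v (t - s (φ k)) → u t` for every `t`. -/
def AlmostAutomorphic {E : Type*} [TopologicalSpace E] (u : ℝ → E) : Prop :=
  Continuous u ∧ ∀ s : ℕ → ℝ, ∃ φ : ℕ → ℕ, StrictMono φ ∧ ∃ v : ℝ → E, ∀ t : ℝ,
    Tendsto (fun k => u (t + s (φ k))) atTop (𝓝 (v t)) ∧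
    Tendsto (fun k => v (t - s (φ k))) atTop (𝓝 (u t))

/-- `L^p_loc(ℝ, X)`: (a.e. classes of) strongly measurable functions `ℝ → X` which are in
`L^p(a, b; X)` for every bounded interval `(a, b)`. -/
def LpLoc (X : Type*) [NormedAddCommGroup X] (p : ℝ≥0∞) : Type _ :=
  {u : ℝ →ₘ[volume] X // ∀ a b : ℝ, MemLp u p (volume.restrict (Ioo a b))}

namespace LpLoc

variable {X : Type*} [NormedAddCommGroup X] {p : ℝ≥0∞}

noncomputable instance : CoeFun (LpLoc X p) (fun _ => ℝ → X) := ⟨fun u => (u.1 : ℝ → X)⟩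

theorem memLp_translate (u : LpLoc X p) (t : ℝ) :
    MemLp (fun θ => u (t + θ)) p (volume.restrict (Ioo (0 : ℝ) 1)) := by
  have h : MeasurePreserving (fun θ : ℝ => t + θ) (volume.restrict (Ioo (0 : ℝ) 1))
      (volume.restrict (Ioo t (t + 1))) := by
    have h0 := (measurePreserving_add_left (volume : Measure ℝ) t).restrict_preimage
      (measurableSet_Ioo (a := t) (b := t + 1))
    simpa using h0
  exact (u.2 t (t + 1)).comp_measurePreserving h

/-- The Bochner transform `u^b : ℝ → L^p(0,1;X)`, `u^b(t)(θ) = u(t + θ)`. -/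
noncomputable def bochner (u : LpLoc X p) (t : ℝ) : Lp X p (volume.restrict (Ioo (0 : ℝ) 1)) :=
  (memLp_translate u t).toLp (fun θ => u (t + θ))

/-- The (possibly infinite) distance of the Stepanov norm `‖u‖_{S^p} = sup_t ‖u^b(t)‖_{L^p}`:
`edist u v = sup_t ‖u^b(t) - v^b(t)‖_{L^p(0,1;X)} = sup_t (∫₀¹ ‖u(t+θ) - v(t+θ)‖^p dθ)^{1/p}`.
It is finite on `BS^p`, where it is the distance of the norm. -/
noncomputable instance [Fact (1 ≤ p)] : PseudoEMetricSpace (LpLoc X p) where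
  edist u v := ⨆ t : ℝ, edist (u.bochner t) (v.bochner t)
  edist_self u := by simp
  edist_comm u v := by simp only [edist_comm]
  edist_triangle u v w := iSup_le fun t => (edist_triangle _ (v.bochner t) _).trans
    (add_le_add (le_iSup (fun t => edist (u.bochner t) (v.bochner t)) t)
      (le_iSup (fun t => edist (v.bochner t) (w.bochner t)) t))

theorem edist_eq_iSup_eLpNorm [Fact (1 ≤ p)] (u v : LpLoc X p) :
    edist u v =
      ⨆ t : ℝ, eLpNorm (fun θ => u (t + θ) - v (t + θ)) p (volume.restrict (Ioo (0 : ℝ) 1)) := by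
  change (⨆ t : ℝ, edist (u.bochner t) (v.bochner t)) = _
  refine iSup_congr fun t => ?_
  rw [bochner, bochner, Lp.edist_toLp_toLp]
  rfl

end LpLoc

/-- `BS^p(ℝ, X)`: Stepanov bounded functions, those `u` whose Bochner transform is a bounded
continuous function `ℝ → L^p(0,1;X)`. -/
def BS (X : Type*) [NormedAddCommGroup X] (p : ℝ≥0∞) [Fact (1 ≤ p)] : Set (LpLoc X p) :=
  {u | Continuous u.bochner ∧ Bornology.IsBounded (range u.bochner)}

/-- `S^p_aa(ℝ, X)`: Stepanov almost automorphic functions. -/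
def Saa (X : Type*) [NormedAddCommGroup X] (p : ℝ≥0∞) [Fact (1 ≤ p)] : Set (LpLoc X p) :=
  {u | AlmostAutomorphic u.bochner}

/-- `L^p_1(ℝ, X)`: the 1-periodic functions in `L^p_loc(ℝ, X)`. -/
def Lp1 (X : Type*) [NormedAddCommGroup X] (p : ℝ≥0∞) : Set (LpLoc X p) :=
  {u | ∀ᵐ t : ℝ, u (t + 1) = u t}

/-- The Nemytskii operator `u ↦ f(·, u(·))` is well-defined from `A` to `B` and continuous
(for the Stepanov distances). The value of the operator is determined by `f` as an a.e. class,
and does not depend on the representative of `u`. -/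
def NemytskiiContinuous {X Y : Type*} [NormedAddCommGroup X] [NormedAddCommGroup Y]
    {p q : ℝ≥0∞} [Fact (1 ≤ p)] [Fact (1 ≤ q)] (f : ℝ → X → Y)
    (A : Set (LpLoc X p)) (B : Set (LpLoc Y q)) : Prop :=
  ∃ N : A → B, (∀ u : A, ∀ᵐ t : ℝ, (N u).1 t = f t (u.1 t)) ∧ Continuous N

/-- The a.e. class of the function `g : ℝ → Y` belongs to `B`. -/
def ClassMem {Y : Type*} [NormedAddCommGroup Y] {q : ℝ≥0∞} (g : ℝ → Y)
    (B : Set (LpLoc Y q)) : Prop :=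
  ∃ w ∈ B, ∀ᵐ t : ℝ, w t = g t

end Stepanov

/-!
The substance is that continuity on periodic functions, together with almost automorphy of the
functions `f(·, x)`, forces continuity on all Stepanov almost automorphic functions.

The periodic extension of `w ∈ L^p(0,1;X)` from the window `(t, t + 1)` turns the operator on
periodic functions into a family of maps `F_t(w) = f(t + ·, w(·))` from `L^p(0,1;X)` to
`L^q(0,1;Y)` (`windowMap`), and for every `u` in `L^p_loc` the Bochner transform of `f(·, u(·))` at
`t` is `F_t(u^b(t))` (`exists_nemytskii`). Three facts about this family suffice.

* It is equicontinuous in `t ∈ ℝ` (`equicontinuous_windowMap`). The Stepanov distance of two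
  periodic functions is the distance of their windows, and the translates of a periodic function
  form a compact set, near which a continuous operator is uniformly continuous.
* For each `w`, the function `t ↦ F_t(w)` is almost automorphic (`almostAutomorphic_windowMap`).
  This holds for simple `w` by the hypothesis on `f(·, x)`, and the set of such `w` is closed.
* Superposing an equicontinuous family of almost automorphic functions with an almost automorphic
  function gives an almost automorphic function (`AlmostAutomorphic.eval`). The range of a
  continuous function on `ℝ` is separable, so a diagonal argument yields one subsequence along which
  the translates of the family converge at a dense sequence of points, hence, by equicontinuity, on
  its closure.

Continuity of the operator follows because an almost automorphic function has relatively compact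
range, near which the equicontinuous family has a uniform modulus of continuity
(`exists_uniform_modulus_of_isCompact`). In the other direction, periodic functions are Stepanov
almost automorphic, constants are periodic, and almost automorphic functions are bounded.
-/

namespace Stepanov

/-! ### Almost automorphic functions -/

/-- The diagonal argument: properties `Q j` of subsequences, each of which can be reached by passing
to a further subsequence and depends only on a tail, hold simultaneously for some subsequence. -/
theorem exists_strictMono_diagonal (Q : ℕ → (ℕ → ℕ) → Prop)
    (hQ : ∀ j (φ : ℕ → ℕ), StrictMono φ → ∃ ψ : ℕ → ℕ, StrictMono ψ ∧ Q j (φ ∘ ψ))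
    (htail : ∀ j (φ m ψ : ℕ → ℕ), Q j φ → Tendsto m atTop atTop →
      (∀ᶠ k in atTop, ψ k = φ (m k)) → Q j ψ) :
    ∃ ψ, StrictMono ψ ∧ ∀ j, Q j ψ := by
  choose! r hr hrQ using hQ
  -- `σ n` is the `n`-th of the nested subsequences; it satisfies `Q n`.
  let σ : ℕ → ℕ → ℕ := fun n =>
    Nat.rec (motive := fun _ => ℕ → ℕ) (r 0 id) (fun n φ => φ ∘ r (n + 1) φ) n
  have hσs : ∀ n, σ (n + 1) = σ n ∘ r (n + 1) (σ n) := fun n => rfl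
  have hσ : ∀ n, StrictMono (σ n) := by
    intro n
    induction n with
    | zero => exact hr 0 id strictMono_id
    | succ n ih => rw [hσs]; exact ih.comp (hr _ _ ih)
  have hσQ : ∀ n, Q n (σ n) := by
    intro n
    cases n with
    | zero => exact hrQ 0 id strictMono_id
    | succ n => rw [hσs]; exact hrQ _ _ (hσ n)
  have hfac : ∀ j k, j ≤ k → ∀ n, ∃ m, n ≤ m ∧ σ k n = σ j m := by
    intro j k hjk
    induction k, hjk using Nat.le_induction with
    | base => exact fun n => ⟨n, le_rfl, rfl⟩
    | succ k _ ih =>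
      intro n
      obtain ⟨m, hm, h⟩ := ih (r (k + 1) (σ k) n)
      exact ⟨m, ((hr _ _ (hσ k)).le_apply).trans hm, h⟩
  refine ⟨fun k => σ k k, strictMono_nat_of_lt_succ fun k => ?_, fun j => ?_⟩
  · rw [hσs]
    exact hσ k (k.lt_succ_self.trans_le (hr _ _ (hσ k)).le_apply)
  · choose! m hm hmeq using hfac j
    refine htail j (σ j) (fun k => m k k) _ (hσQ j) ?_ ?_
    · refine tendsto_atTop_mono' atTop ?_ tendsto_id
      filter_upwards [eventually_ge_atTop j] with k hk using hm k hk k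
    · filter_upwards [eventually_ge_atTop j] with k hk using hmeq k hk k

namespace AlmostAutomorphic

theorem comp {E E' : Type*} [TopologicalSpace E] [TopologicalSpace E'] {u : ℝ → E}
    (hu : AlmostAutomorphic u) {g : E → E'} (hg : Continuous g) :
    AlmostAutomorphic fun t => g (u t) := by
  refine ⟨hg.comp hu.1, fun s => ?_⟩
  obtain ⟨φ, hφ, v, hv⟩ := hu.2 s
  exact ⟨φ, hφ, fun t => g (v t), fun t =>
    ⟨(hg.tendsto _).comp (hv t).1, (hg.tendsto _).comp (hv t).2⟩⟩

theorem prodMk {E E' : Type*} [TopologicalSpace E] [TopologicalSpace E'] {u : ℝ → E}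
    {u' : ℝ → E'} (hu : AlmostAutomorphic u) (hu' : AlmostAutomorphic u') :
    AlmostAutomorphic fun t => (u t, u' t) := by
  refine ⟨hu.1.prodMk hu'.1, fun s => ?_⟩
  obtain ⟨φ, hφ, v, hv⟩ := hu.2 s
  obtain ⟨ψ, hψ, v', hv'⟩ := hu'.2 (s ∘ φ)
  refine ⟨φ ∘ ψ, hφ.comp hψ, fun t => (v t, v' t), fun t => ⟨?_, ?_⟩⟩
  · exact ((hv t).1.comp hψ.tendsto_atTop).prodMk_nhds (hv' t).1
  · exact ((hv t).2.comp hψ.tendsto_atTop).prodMk_nhds (hv' t).2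

theorem const {E : Type*} [TopologicalSpace E] (x : E) : AlmostAutomorphic fun _ : ℝ => x :=
  ⟨continuous_const, fun _ => ⟨id, strictMono_id, fun _ => x, fun _ =>
    ⟨tendsto_const_nhds, tendsto_const_nhds⟩⟩⟩

/-- Countably many almost automorphic functions admit a common subsequence. -/
theorem exists_common_subseq {E : Type*} [TopologicalSpace E] {u : ℕ → ℝ → E}
    (hu : ∀ j, AlmostAutomorphic (u j)) (s : ℕ → ℝ) :
    ∃ φ : ℕ → ℕ, StrictMono φ ∧ ∃ v : ℕ → ℝ → E, ∀ j t,
      Tendsto (fun k => u j (t + s (φ k))) atTop (𝓝 (v j t)) ∧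
      Tendsto (fun k => v j (t - s (φ k))) atTop (𝓝 (u j t)) := by
  have h := exists_strictMono_diagonal
    (fun j φ => ∃ v : ℝ → E, ∀ t,
      Tendsto (fun k => u j (t + s (φ k))) atTop (𝓝 (v t)) ∧
      Tendsto (fun k => v (t - s (φ k))) atTop (𝓝 (u j t)))
    (fun j φ _ => (hu j).2 (s ∘ φ)) (by
      rintro j φ m ψ ⟨v, hv⟩ hm hψ
      refine ⟨v, fun t => ⟨((hv t).1.comp hm).congr' ?_, ((hv t).2.comp hm).congr' ?_⟩⟩ <;>
      · filter_upwards [hψ] with k hk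
        simp [hk])
  obtain ⟨φ, hφ, h⟩ := h
  choose v hv using h
  exact ⟨φ, hφ, v, hv⟩

/-- Modulo the period, every sequence of translations has a convergent subsequence. -/
theorem of_periodic {E : Type*} [TopologicalSpace E] {u : ℝ → E} (hu : Continuous u)
    (hper : Function.Periodic u 1) : AlmostAutomorphic u := by
  refine ⟨hu, fun s => ?_⟩
  obtain ⟨r, -, φ, hφ, hr⟩ := (isCompact_Icc (a := (0 : ℝ)) (b := 1)).tendsto_subseq
    (x := fun k => Int.fract (s k)) fun k => ⟨Int.fract_nonneg _, (Int.fract_lt_one _).le⟩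
  have hadd : ∀ t a, u (t + a) = u (t + Int.fract a) := fun t a => by
    rw [← (hper.int_mul ⌊a⌋) (t + Int.fract a), mul_one, add_assoc, Int.fract_add_floor]
  have hsub : ∀ t a, u (t - a) = u (t - Int.fract a) := fun t a => by
    rw [← (hper.int_mul ⌊a⌋) (t - a), mul_one, Int.fract, sub_sub_eq_add_sub, add_sub_right_comm]
  refine ⟨φ, hφ, fun t => u (t + r), fun t => ⟨?_, ?_⟩⟩
  · exact ((hu.tendsto _).comp (tendsto_const_nhds.add hr)).congr fun k => (hadd t _).symm
  · have h : ∀ k, u (t - s (φ k) + r) = u (t + r - Int.fract (s (φ k))) := fun k => by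
      rw [← hsub, sub_add_eq_add_sub]
    simp only [h]
    have h1 := (hu.tendsto _).comp ((tendsto_const_nhds (x := t + r)).sub hr)
    rwa [add_sub_cancel_right] at h1

theorem isCompact_closure_range {E : Type*} [PseudoMetricSpace E] {u : ℝ → E}
    (hu : AlmostAutomorphic u) : IsCompact (closure (range u)) := by
  refine isCompact_iff_isSeqCompact.2 fun x hx => ?_
  have h : ∀ n : ℕ, ∃ s : ℝ, dist (x n) (u s) < 1 / ((n : ℝ) + 1) := fun n => by
    obtain ⟨_, ⟨s, rfl⟩, hs⟩ := Metric.mem_closure_iff.1 (hx n) _ Nat.one_div_pos_of_nat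
    exact ⟨s, hs⟩
  choose s hs using h
  obtain ⟨φ, hφ, v, hv⟩ := hu.2 s
  have h0 : Tendsto (fun k => u (s (φ k))) atTop (𝓝 (v 0)) := by simpa using (hv 0).1
  refine ⟨v 0, mem_closure_of_tendsto h0 (Eventually.of_forall fun k => mem_range_self _),
    φ, hφ, ?_⟩
  refine h0.congr_dist ?_
  have := (tendsto_one_div_add_atTop_nhds_zero_nat (𝕜 := ℝ)).comp hφ.tendsto_atTop
  refine squeeze_zero (fun _ => dist_nonneg) (fun k => ?_) this
  rw [dist_comm]
  exact (hs (φ k)).le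

end AlmostAutomorphic

/-! ### Equicontinuous families and superposition -/

section Equicontinuous

variable {E E' : Type*} [PseudoMetricSpace E] [MetricSpace E']

/-- For equicontinuous maps, convergence on a dense sequence gives convergence along a moving
argument. -/
theorem tendsto_of_equicontinuousAt {ι : Type*} {l : Filter ι} {G : ι → E → E'} {g : E → E'}
    {w : ℕ → E} (hw : DenseRange w) {z : E} {x : ι → E} (hG : EquicontinuousAt G z)
    (hg : ContinuousAt g z) (hGw : ∀ j, Tendsto (fun i => G i (w j)) l (𝓝 (g (w j))))
    (hx : Tendsto x l (𝓝 z)) : Tendsto (fun i => G i (x i)) l (𝓝 (g z)) := by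
  have h1 : Tendsto (fun i => G i z) l (𝓝 (g z)) :=
    hG.tendsto_of_mem_closure (s := range w) (hg.tendsto.mono_left nhdsWithin_le_nhds)
      (by rintro _ ⟨j, rfl⟩; exact hGw j) (hw z)
  refine h1.congr_dist (Metric.tendsto_nhds.2 fun ε hε => ?_)
  obtain ⟨δ, hδ, h⟩ := Metric.equicontinuousAt_iff.1 hG ε hε
  filter_upwards [Metric.tendsto_nhds.1 hx δ hδ] with i hi
  simpa using h _ hi i

/-- An equicontinuous sequence which converges at the points of a dense sequence converges
everywhere, the target being complete. -/
theorem exists_tendsto_of_equicontinuous [CompleteSpace E'] {G : ℕ → E → E'} {w : ℕ → E}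
    (hw : DenseRange w) (hG : Equicontinuous G)
    (hGw : ∀ j, ∃ y, Tendsto (fun k => G k (w j)) atTop (𝓝 y)) (z : E) :
    ∃ y, Tendsto (fun k => G k z) atTop (𝓝 y) := by
  refine cauchySeq_tendsto_of_complete (Metric.cauchySeq_iff.2 fun ε hε => ?_)
  obtain ⟨δ, hδ, h⟩ := Metric.equicontinuousAt_iff.1 (hG z) (ε / 3) (by positivity)
  obtain ⟨j, hj⟩ := hw.exists_dist_lt z hδ
  obtain ⟨y, hy⟩ := hGw j
  obtain ⟨n, hn⟩ := Metric.cauchySeq_iff.1 hy.cauchySeq (ε / 3) (by positivity)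
  refine ⟨n, fun a ha b hb => ?_⟩
  rw [dist_comm] at hj
  have h1 := h _ hj a
  have h2 := h _ hj b
  rw [dist_comm] at h2
  have h3 := hn a ha b hb
  have h4 := dist_triangle4 (G a z) (G a (w j)) (G b (w j)) (G b z)
  linarith

/-- Almost automorphic superposition in the separable case: along a common subsequence for `u` and
the functions `F · (w j)`, the translates of `F` converge to a family `Φ` with the same moduli of
continuity, and `t ↦ Φ t (v t)` is the required limit. -/
theorem AlmostAutomorphic.eval_of_denseRange [CompleteSpace E'] {F : ℝ → E → E'}
    (hF : Equicontinuous F) {w : ℕ → E} (hw : DenseRange w)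
    (hFw : ∀ j, AlmostAutomorphic fun t => F t (w j)) {u : ℝ → E} (hu : AlmostAutomorphic u) :
    AlmostAutomorphic fun t => F t (u t) := by
  refine ⟨continuous_iff_continuousAt.2 fun t => ?_, fun s => ?_⟩
  · exact tendsto_of_equicontinuousAt hw (hF (u t)) (hF.continuous t).continuousAt
      (fun j => (hFw j).1.tendsto t) (hu.1.tendsto t)
  obtain ⟨φ₁, hφ₁, v, hv⟩ := hu.2 s
  obtain ⟨φ₂, hφ₂, W, hW⟩ := exists_common_subseq hFw (s ∘ φ₁)
  have hlim : ∀ t z, ∃ y, Tendsto (fun k => F (t + s (φ₁ (φ₂ k))) z) atTop (𝓝 y) := fun t =>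
    exists_tendsto_of_equicontinuous hw (fun x U hU => (hF x U hU).mono fun y hy k => hy _)
      fun j => ⟨_, (hW j t).1⟩
  choose Φ hΦ using hlim
  have hΦw : ∀ t j, Φ t (w j) = W j t := fun t j => tendsto_nhds_unique (hΦ t (w j)) (hW j t).1
  -- The limit family inherits the moduli of continuity of `F`.
  have hΦeq : Equicontinuous Φ := fun x => Metric.equicontinuousAt_iff.2 fun ε hε => by
    obtain ⟨δ, hδ, h⟩ := Metric.equicontinuousAt_iff.1 (hF x) (ε / 2) (by positivity)
    refine ⟨δ, hδ, fun y hy t => lt_of_le_of_lt ?_ (half_lt_self hε)⟩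
    exact le_of_tendsto ((hΦ t x).dist (hΦ t y)) (Eventually.of_forall fun k => (h y hy _).le)
  refine ⟨φ₁ ∘ φ₂, hφ₁.comp hφ₂, fun t => Φ t (v t), fun t => ⟨?_, ?_⟩⟩
  · refine tendsto_of_equicontinuousAt (G := fun k => F (t + s (φ₁ (φ₂ k)))) hw
      (fun U hU => (hF (v t) U hU).mono fun y hy k => hy _) (hΦeq.continuous t).continuousAt
      (fun j => hΦ t (w j)) ((hv t).1.comp hφ₂.tendsto_atTop)
  · refine tendsto_of_equicontinuousAt (G := fun k => Φ (t - s (φ₁ (φ₂ k)))) (g := F t) hw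
      (fun U hU => (hΦeq (u t) U hU).mono fun y hy k => hy _) (hF.continuous t).continuousAt
      (fun j => ?_) ((hv t).2.comp hφ₂.tendsto_atTop)
    simp only [hΦw]
    exact (hW j t).2

/-- Only the values of `F` on the closure of `range w` enter, so the density of `w` can be replaced
by the condition that `u` stays in this closure. -/
theorem AlmostAutomorphic.eval_of_mem_closure [CompleteSpace E'] {F : ℝ → E → E'}
    (hF : Equicontinuous F) {w : ℕ → E}
    (hFw : ∀ j, AlmostAutomorphic fun t => F t (w j)) {u : ℝ → E} (hu : AlmostAutomorphic u)
    (huw : ∀ t, u t ∈ closure (range w)) :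
    AlmostAutomorphic fun t => F t (u t) := by
  let S := closure (range w)
  let w' : ℕ → S := fun j => ⟨w j, subset_closure (mem_range_self j)⟩
  have hw' : DenseRange w' := fun z => by
    rw [Topology.IsInducing.subtypeVal.closure_eq_preimage_closure_image, ← range_comp]
    exact z.2
  refine AlmostAutomorphic.eval_of_denseRange (E := S) (F := fun t z => F t z)
    (fun z U hU => continuous_subtype_val.continuousAt (hF z U hU)) hw' hFw
    (u := fun t => ⟨u t, huw t⟩) ⟨hu.1.subtype_mk _, fun s => ?_⟩
  obtain ⟨φ, hφ, v, hv⟩ := hu.2 s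
  exact ⟨φ, hφ, fun t => ⟨v t, isClosed_closure.mem_of_tendsto (hv t).1
    (Eventually.of_forall fun _ => huw _)⟩, fun t =>
    ⟨tendsto_subtype_rng.2 (hv t).1, tendsto_subtype_rng.2 (hv t).2⟩⟩

theorem isClosed_setOf_almostAutomorphic [CompleteSpace E'] {F : ℝ → E → E'}
    (hF : Equicontinuous F) : IsClosed {z | AlmostAutomorphic fun t => F t z} := by
  refine isClosed_of_closure_subset fun z hz => ?_
  obtain ⟨w, hw, hwz⟩ := mem_closure_iff_seq_limit.1 hz
  exact AlmostAutomorphic.eval_of_mem_closure hF hw (.const z)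
    fun _ => mem_closure_of_tendsto hwz (Eventually.of_forall fun k => mem_range_self k)

/-- Superposition of an equicontinuous family of almost automorphic functions with an almost
automorphic function. The space need not be separable, since the range of `u` is. -/
theorem AlmostAutomorphic.eval [CompleteSpace E'] {F : ℝ → E → E'}
    (hF : Equicontinuous F) (hFz : ∀ z, AlmostAutomorphic fun t => F t z) {u : ℝ → E}
    (hu : AlmostAutomorphic u) : AlmostAutomorphic fun t => F t (u t) := by
  obtain ⟨r, hr⟩ := TopologicalSpace.exists_dense_seq ℝ
  refine AlmostAutomorphic.eval_of_mem_closure hF (w := u ∘ r) (fun j => hFz _) hu fun t => ?_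
  rw [range_comp]
  exact image_closure_subset_closure_image hu.1 ⟨t, hr t, rfl⟩

/-- An equicontinuous family is uniformly continuous near a compact set, with a modulus that
does not depend on the member of the family. -/
theorem exists_uniform_modulus_of_isCompact {ι : Type*} {F : ι → E → E'} (hF : Equicontinuous F)
    {K : Set E} (hK : IsCompact K) {ε : ℝ} (hε : 0 < ε) :
    ∃ δ > 0, ∀ x ∈ K, ∀ y, dist x y < δ → ∀ i, dist (F i x) (F i y) < ε := by
  have h := hK.uniformContinuousAt_of_continuousAt (β := UniformFun ι E') _
    (fun x _ => (equicontinuous_iff_continuous.1 hF).continuousAt)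
    ((UniformFun.hasBasis_uniformity ι E').mem_of_mem (Metric.dist_mem_uniformity hε))
  obtain ⟨δ, hδ, h⟩ := Metric.mem_uniformity_dist.1 h
  exact ⟨δ, hδ, fun x hx y hxy => h hxy hx⟩

end Equicontinuous

/-! ### Windows of unit length and the Bochner transform -/

theorem measurePreserving_window (t : ℝ) :
    MeasurePreserving (fun θ : ℝ => t + θ) (volume.restrict (Ioo (0 : ℝ) 1))
      (volume.restrict (Ioo t (t + 1))) := by
  simpa using (measurePreserving_add_left (volume : Measure ℝ) t).restrict_preimage
    (measurableSet_Ioo (a := t) (b := t + 1))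

theorem ae_window {P : ℝ → Prop} (h : ∀ᵐ s : ℝ, P s) (t : ℝ) :
    ∀ᵐ θ ∂volume.restrict (Ioo (0 : ℝ) 1), P (t + θ) :=
  (measurePreserving_window t).quasiMeasurePreserving.ae (ae_restrict_of_ae h)

theorem restrict_Ioc_eq_restrict_Ioo (n : ℤ) :
    volume.restrict (Ioc (n : ℝ) (n + 1)) = volume.restrict (Ioo (n : ℝ) (n + 1)) :=
  Measure.restrict_congr_set Ioo_ae_eq_Ioc.symm

/-- Translation modulo one preserves Lebesgue measure on the unit interval. -/
theorem measurePreserving_fract (c : ℝ) :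
    MeasurePreserving (fun θ : ℝ => Int.fract (c + θ)) (volume.restrict (Ioo (0 : ℝ) 1))
      (volume.restrict (Ioo (0 : ℝ) 1)) := by
  have h : MeasurePreserving (Int.fract : ℝ → ℝ) (volume.restrict (Ioo c (c + 1)))
      (volume.restrict (Ioo (0 : ℝ) 1)) := by
    refine ⟨measurable_fract, Measure.ext fun s hs => ?_⟩
    rw [Measure.map_apply measurable_fract hs, Measure.restrict_congr_set Ioo_ae_eq_Ioc,
      Measure.restrict_apply (measurable_fract hs)]
    -- The preimage of `s` is invariant under integer translations, and both intervals are
    -- fundamental domains.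
    have := (isAddFundamentalDomain_Ioc zero_lt_one c).measure_set_eq
      (isAddFundamentalDomain_Ioc zero_lt_one 0) (measurable_fract hs) (fun g => by
        obtain ⟨_, ⟨n, rfl⟩⟩ := g
        ext x
        simp [AddSubgroup.vadd_def])
    rw [this, zero_add, ← Measure.restrict_apply (measurable_fract hs),
      ← Measure.restrict_congr_set Ioo_ae_eq_Ioc, Measure.restrict_apply (measurable_fract hs),
      Measure.restrict_apply hs]
    congr 1
    ext x
    simp only [mem_inter_iff, mem_preimage, and_congr_left_iff]
    intro hx
    rw [Int.fract_eq_self.2 ⟨hx.1.le, hx.2⟩]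
  exact h.comp (measurePreserving_window c)

theorem uniformContinuous_of_periodic {E : Type*} [PseudoEMetricSpace E] {u : ℝ → E}
    (hu : Continuous u) (hper : Function.Periodic u 1) : UniformContinuous u := by
  intro r hr
  have h := (isCompact_Icc (a := (0 : ℝ)) (b := 1)).uniformContinuousAt_of_continuousAt u
    (fun _ _ => hu.continuousAt) hr
  obtain ⟨δ, hδ, h⟩ := Metric.mem_uniformity_dist.1 h
  refine Metric.mem_uniformity_dist.2 ⟨δ, hδ, fun a b hab => ?_⟩
  -- Both points are moved by the same integer, so that the first one lies in `[0, 1]`.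
  have := @h (a - ⌊a⌋) (b - ⌊a⌋) (by simpa [Real.dist_eq] using hab)
    ⟨Int.fract_nonneg a, (Int.fract_lt_one a).le⟩
  have hu' : ∀ x, u (x - ⌊a⌋) = u x := fun x => by simpa using hper.sub_int_mul_eq ⌊a⌋ (x := x)
  rwa [hu', hu'] at this

section

variable {X : Type*} [NormedAddCommGroup X] {p : ℝ≥0∞}

namespace LpLoc

theorem coe_bochner (u : LpLoc X p) (t : ℝ) :
    u.bochner t =ᵐ[volume.restrict (Ioo (0 : ℝ) 1)] fun θ => u (t + θ) :=
  MemLp.coeFn_toLp _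

theorem edist_bochner_le [Fact (1 ≤ p)] (u v : LpLoc X p) (t : ℝ) :
    edist (u.bochner t) (v.bochner t) ≤ edist u v :=
  le_iSup (fun t => edist (u.bochner t) (v.bochner t)) t

/-- A function is in `L^p_loc` as soon as it is in `L^p` on all windows of length one. -/
theorem exists_of_memLp_window [Fact (1 ≤ p)] (hp : p ≠ ∞) {g : ℝ → X}
    (h : ∀ t : ℝ, MemLp (fun θ => g (t + θ)) p (volume.restrict (Ioo (0 : ℝ) 1))) :
    ∃ u : LpLoc X p, ∀ᵐ s : ℝ, u s = g s := by
  have hp0 : p ≠ 0 := (zero_lt_one.trans_le Fact.out).ne'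
  have h' : ∀ t : ℝ, MemLp g p (volume.restrict (Ioo t (t + 1))) := fun t => by
    rw [← (measurePreserving_window t).map_eq, (measurableEmbedding_addLeft t).memLp_map_measure_iff]
    exact h t
  have hg : AEStronglyMeasurable g volume := by
    rw [← Measure.restrict_univ (μ := volume), ← iUnion_Ioc_intCast (α := ℝ),
      aestronglyMeasurable_iUnion_iff]
    intro n
    rw [restrict_Ioc_eq_restrict_Ioo]
    exact (h' n).1
  have hloc : LocallyIntegrable (fun s => ‖g s‖ ^ p.toReal) volume := fun s => by
    refine ⟨Ioo (s - 1 / 2) (s - 1 / 2 + 1), Ioo_mem_nhds (by linarith) (by linarith), ?_⟩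
    exact (h' _).integrable_norm_rpow hp0 hp
  refine ⟨⟨AEEqFun.mk g hg, fun a b => ?_⟩, AEEqFun.coeFn_mk g hg⟩
  refine MemLp.ae_eq (ae_restrict_of_ae (AEEqFun.coeFn_mk g hg).symm) ?_
  rw [← integrable_norm_rpow_iff hg.restrict hp0 hp]
  exact (hloc.integrableOn_isCompact isCompact_Icc).mono_set Ioo_subset_Icc_self

/-- The Bochner transform of a function in `L^p_loc` is always continuous; membership in `BS^p` is
only a matter of boundedness. -/
theorem continuous_bochner [NormedSpace ℝ X] [Fact (1 ≤ p)] (hp : p ≠ ∞) (u : LpLoc X p) :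
    Continuous u.bochner := by
  refine continuous_iff_continuousAt.2 fun t => ?_
  -- Near `t` only the values of `u` on a bounded interval matter, and the truncation of `u` to
  -- this interval belongs to `L^p(ℝ)`, on which translations act continuously.
  have : Fact (p ≠ ∞) := ⟨hp⟩
  let I := Ioo (t - 1) (t + 2)
  have hg : MemLp (I.indicator u) p volume := (memLp_indicator_iff_restrict measurableSet_Ioo).2
    (u.2 _ _)
  let U : ℝ → Lp X p (volume.restrict (Ioo (0 : ℝ) 1)) := fun r =>
    LpToLpRestrictCLM ℝ X ℝ volume p (Ioo (0 : ℝ) 1) (DomAddAct.mk r +ᵥ hg.toLp)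
  have hU : Continuous U := by
    refine (ContinuousLinearMap.continuous _).comp ?_
    exact (DomAddAct.continuous_mk).vadd continuous_const
  refine hU.continuousAt.congr ?_
  filter_upwards [Ioo_mem_nhds (sub_one_lt t) (lt_add_one t)] with r hr
  refine Lp.ext ?_
  filter_upwards [LpToLpRestrictCLM_coeFn ℝ (Ioo (0 : ℝ) 1) (DomAddAct.mk r +ᵥ hg.toLp),
    ae_restrict_of_ae (Lp.ext_iff.1 (DomAddAct.mk_vadd_toLp r hg)), u.coe_bochner r,
    ae_restrict_of_ae (MemLp.coeFn_toLp
      (hg.comp_measurePreserving (measurePreserving_vadd r (volume : Measure ℝ)))),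
    ae_restrict_mem measurableSet_Ioo] with θ h1 h2 h3 h4 h5
  rw [h1, h2, h3]
  refine h4.trans (indicator_of_mem ?_ _)
  exact ⟨by simp only [vadd_eq_add]; linarith [hr.1, h5.1],
    by simp only [vadd_eq_add]; linarith [hr.2, h5.2]⟩

end LpLoc

theorem Lp1.periodic_bochner {u : LpLoc X p} (hu : u ∈ Lp1 X p) :
    Function.Periodic u.bochner 1 := fun t => by
  refine Lp.ext ?_
  filter_upwards [u.coe_bochner t, u.coe_bochner (t + 1), ae_window hu t] with θ h1 h2 h3
  rw [h1, h2, ← h3, add_right_comm]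

theorem Lp1_subset_Saa [NormedSpace ℝ X] [Fact (1 ≤ p)] (hp : p ≠ ∞) : Lp1 X p ⊆ Saa X p :=
  fun u hu => .of_periodic (u.continuous_bochner hp) (Lp1.periodic_bochner hu)

theorem Saa_subset_BS [Fact (1 ≤ p)] : Saa X p ⊆ BS X p := fun _ hu =>
  ⟨hu.1, hu.isCompact_closure_range.isBounded.subset subset_closure⟩

/-! ### Periodic extension -/

variable [Fact (1 ≤ p)]

theorem exists_periodicExt (hp : p ≠ ∞) (t : ℝ) (w : Lp X p (volume.restrict (Ioo (0 : ℝ) 1))) :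
    ∃ u : LpLoc X p, ∀ᵐ s : ℝ, u s = w (Int.fract (s - t)) := by
  refine LpLoc.exists_of_memLp_window hp fun r => ?_
  have := (Lp.memLp w).comp_measurePreserving (measurePreserving_fract (r - t))
  refine this.ae_eq (ae_of_all _ fun θ => ?_)
  simp [add_sub_right_comm]

variable (hp : p ≠ ∞)

/-- The 1-periodic function whose window on `(t, t + 1)`, moved to `(0, 1)`, is `w`. As a class it is
`s ↦ w (Int.fract (s - t))`. -/
noncomputable def periodicExt (t : ℝ) (w : Lp X p (volume.restrict (Ioo (0 : ℝ) 1))) :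
    LpLoc X p := (exists_periodicExt hp t w).choose

theorem coe_periodicExt (t : ℝ) (w : Lp X p (volume.restrict (Ioo (0 : ℝ) 1))) :
    ∀ᵐ s : ℝ, periodicExt hp t w s = w (Int.fract (s - t)) :=
  (exists_periodicExt hp t w).choose_spec

theorem periodicExt_mem_Lp1 (t : ℝ) (w : Lp X p (volume.restrict (Ioo (0 : ℝ) 1))) :
    periodicExt hp t w ∈ Lp1 X p := by
  have h1 := coe_periodicExt hp t w
  have h2 := (measurePreserving_add_right (volume : Measure ℝ) 1).quasiMeasurePreserving.ae h1
  change ∀ᵐ s : ℝ, _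
  filter_upwards [h1, h2] with s h1 h2
  rw [h1, h2, add_sub_right_comm, Int.fract_add_one]

theorem bochner_periodicExt (t s : ℝ) (w : Lp X p (volume.restrict (Ioo (0 : ℝ) 1))) :
    (periodicExt hp t w).bochner s =ᵐ[volume.restrict (Ioo (0 : ℝ) 1)]
      fun θ => w (Int.fract (s - t + θ)) := by
  filter_upwards [LpLoc.coe_bochner (periodicExt hp t w) s,
    ae_window (coe_periodicExt hp t w) s] with θ h1 h2
  rw [h1, h2, add_sub_right_comm]

theorem bochner_periodicExt_self (t : ℝ) (w : Lp X p (volume.restrict (Ioo (0 : ℝ) 1))) :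
    (periodicExt hp t w).bochner t = w := by
  refine Lp.ext ?_
  filter_upwards [bochner_periodicExt hp t t w, ae_restrict_mem measurableSet_Ioo] with θ h1 h2
  rw [h1, sub_self, zero_add, Int.fract_eq_self.2 ⟨h2.1.le, h2.2⟩]

/-- All windows of a 1-periodic function have the same `L^p` norm, so periodic extension is
isometric for the Stepanov distance. -/
theorem edist_periodicExt (t : ℝ) (w w' : Lp X p (volume.restrict (Ioo (0 : ℝ) 1))) :
    edist (periodicExt hp t w) (periodicExt hp t w') = edist w w' := by
  have h : ∀ s, edist ((periodicExt hp t w).bochner s) ((periodicExt hp t w').bochner s)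
      = edist w w' := fun s => by
    have hm := measurePreserving_fract (s - t)
    rw [Lp.edist_def, Lp.edist_def,
      ← eLpNorm_comp_measurePreserving ((Lp.aestronglyMeasurable w).sub
        (Lp.aestronglyMeasurable w')) hm]
    refine eLpNorm_congr_ae ?_
    exact (bochner_periodicExt hp t s w).sub (bochner_periodicExt hp t s w')
  change (⨆ s, _) = _
  simp only [h, iSup_const]

theorem bochner_periodicExt_eq (t s : ℝ) (w : Lp X p (volume.restrict (Ioo (0 : ℝ) 1))) :
    (periodicExt hp t w).bochner s = (periodicExt hp 0 w).bochner (s - t) := by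
  refine Lp.ext ((bochner_periodicExt hp t s w).trans ?_)
  simpa using (bochner_periodicExt hp 0 (s - t) w).symm

theorem periodicExt_add_one (t : ℝ) (w : Lp X p (volume.restrict (Ioo (0 : ℝ) 1))) :
    periodicExt hp (t + 1) w = periodicExt hp t w := by
  refine Subtype.ext (AEEqFun.ext ?_)
  filter_upwards [coe_periodicExt hp (t + 1) w, coe_periodicExt hp t w] with s h1 h2
  rw [h1, h2, ← sub_sub, Int.fract_sub_one]

/-- The translates of a fixed periodic function depend continuously on the translation. -/
theorem continuous_periodicExt [NormedSpace ℝ X] (w : Lp X p (volume.restrict (Ioo (0 : ℝ) 1))) :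
    Continuous fun t => periodicExt hp t w := by
  have hper := Lp1.periodic_bochner (periodicExt_mem_Lp1 hp 0 w)
  have huc : UniformContinuous (periodicExt hp 0 w).bochner :=
    uniformContinuous_of_periodic ((periodicExt hp 0 w).continuous_bochner hp) hper
  refine EMetric.continuous_iff.2 fun t ε hε => ?_
  obtain ⟨η, hη, hηε⟩ := exists_between hε
  obtain ⟨δ, hδ, h⟩ := EMetric.uniformContinuous_iff.1 huc η hη
  refine ⟨δ, hδ, fun r hr => lt_of_le_of_lt (iSup_le fun s => ?_) hηε⟩
  rw [bochner_periodicExt_eq, bochner_periodicExt_eq hp t]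
  refine (h ?_).le
  rwa [edist_sub_left]

end

/-! ### The Nemytskii operator -/

section

/-- Cutting off to a measurable set is a well-defined continuous operation on `L^q`. -/
theorem exists_continuous_indicator {Y : Type*} [NormedAddCommGroup Y] {q : ℝ≥0∞}
    [Fact (1 ≤ q)] {α : Type*} [MeasurableSpace α] {μ : Measure α} {A : Set α}
    (hA : MeasurableSet A) :
    ∃ g : Lp Y q μ → Lp Y q μ, Continuous g ∧ ∀ y, g y =ᵐ[μ] A.indicator y := by
  refine ⟨fun y => ((Lp.memLp y).indicator hA).toLp _, LipschitzWith.continuous (K := 1)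
    fun y z => ?_, fun y => MemLp.coeFn_toLp _⟩
  rw [Lp.edist_toLp_toLp, Lp.edist_def, ENNReal.coe_one, one_mul, ← indicator_sub']
  exact eLpNorm_indicator_le _

variable {X Y : Type*} [NormedAddCommGroup X]
  [NormedAddCommGroup Y] {p q : ℝ≥0∞} [Fact (1 ≤ p)]
  {f : ℝ → X → Y} {B : Set (LpLoc Y q)}

/-- The map `w ↦ f(t + ·, w(·))` from `L^p(0,1;X)` to `L^q(0,1;Y)`, read off from a Nemytskii
operator `N` on periodic functions. -/
noncomputable def windowMap (hp : p ≠ ∞) (N : Lp1 X p → B) (t : ℝ)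
    (w : Lp X p (volume.restrict (Ioo (0 : ℝ) 1))) : Lp Y q (volume.restrict (Ioo (0 : ℝ) 1)) :=
  (N ⟨periodicExt hp t w, periodicExt_mem_Lp1 hp t w⟩).1.bochner t

variable (hp : p ≠ ∞) {N : Lp1 X p → B}

theorem coe_windowMap (hN : ∀ u : Lp1 X p, ∀ᵐ t : ℝ, (N u).1 t = f t (u.1 t)) (t : ℝ)
    (w : Lp X p (volume.restrict (Ioo (0 : ℝ) 1))) :
    windowMap hp N t w =ᵐ[volume.restrict (Ioo (0 : ℝ) 1)] fun θ => f (t + θ) (w θ) := by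
  have h := (periodicExt hp t w).coe_bochner t
  rw [bochner_periodicExt_self] at h
  filter_upwards [h, ae_window (hN ⟨periodicExt hp t w, periodicExt_mem_Lp1 hp t w⟩) t,
    LpLoc.coe_bochner (N ⟨periodicExt hp t w, periodicExt_mem_Lp1 hp t w⟩).1 t] with θ h1 h2 h3
  rw [windowMap, h3, h2, h1]

variable [Fact (1 ≤ q)]

/-- Continuity of a Nemytskii operator on the periodic functions makes its window maps
equicontinuous: the translates of one periodic function form a compact set, near which the
operator is uniformly continuous. -/
theorem equicontinuous_windowMap [NormedSpace ℝ X] (hN : Continuous N) :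
    Equicontinuous (windowMap hp N) := by
  intro w
  have hcont : Continuous fun t : ℝ =>
      (⟨periodicExt hp t w, periodicExt_mem_Lp1 hp t w⟩ : Lp1 X p) :=
    (continuous_periodicExt hp w).subtype_mk _
  -- The translates of the periodic extension of `w` form a compact set.
  have hK : IsCompact (range fun t : ℝ =>
      (⟨periodicExt hp t w, periodicExt_mem_Lp1 hp t w⟩ : Lp1 X p)) := by
    rw [← Function.Periodic.image_Icc (c := 1)
      (fun t => Subtype.ext (periodicExt_add_one hp t w)) zero_lt_one 0]
    exact isCompact_Icc.image hcont
  refine Metric.equicontinuousAt_iff.2 fun ε hε => ?_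
  obtain ⟨δ, hδ, h⟩ := mem_uniformity_edist.1 (hK.uniformContinuousAt_of_continuousAt N
    (fun _ _ => hN.continuousAt) (edist_mem_uniformity (ENNReal.ofReal_pos.2 hε)))
  obtain ⟨η, hη, hηδ⟩ := ENNReal.lt_iff_exists_nnreal_btwn.1 hδ
  refine ⟨η, by exact_mod_cast hη, fun w' hw' t => ?_⟩
  rw [← ENNReal.ofReal_lt_ofReal_iff hε, ← edist_dist]
  refine (LpLoc.edist_bochner_le _ _ t).trans_lt (h (a := ⟨_, _⟩) (b := ⟨_, _⟩) ?_ ⟨t, rfl⟩)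
  refine (edist_periodicExt hp t w w').trans_lt (lt_trans ?_ hηδ)
  rw [edist_comm, edist_nndist]
  exact_mod_cast hw'

/-- For fixed `w`, the map `t ↦ f(t + ·, w(·))` is almost automorphic. For simple `w` it is a
combination of the Bochner transforms of the functions `f(·, x)`, cut off to measurable sets; the
general case follows because the family is equicontinuous. -/
theorem almostAutomorphic_windowMap [NormedSpace ℝ X] [CompleteSpace Y]
    (hN : ∀ u : Lp1 X p, ∀ᵐ t : ℝ, (N u).1 t = f t (u.1 t)) (hNc : Continuous N)
    (hf : ∀ x, ClassMem (fun t => f t x) (Saa Y q))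
    (w : Lp X p (volume.restrict (Ioo (0 : ℝ) 1))) :
    AlmostAutomorphic fun t => windowMap hp N t w := by
  choose v hv hvf using hf
  induction w using Lp.induction (hp_ne_top := hp) with
  | indicatorConst c hs hμs =>
    rename_i s
    obtain ⟨g, hg, hgs⟩ := exists_continuous_indicator (Y := Y) (q := q)
      (μ := volume.restrict (Ioo (0 : ℝ) 1)) hs
    obtain ⟨g', hg', hgs'⟩ := exists_continuous_indicator (Y := Y) (q := q)
      (μ := volume.restrict (Ioo (0 : ℝ) 1)) hs.compl
    have heq : ∀ t, windowMap hp N t (Lp.simpleFunc.indicatorConst p hs hμs.ne c) =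
        g ((v c).bochner t) + g' ((v 0).bochner t) := fun t => by
      refine Lp.ext ?_
      filter_upwards [coe_windowMap hp hN t (Lp.simpleFunc.indicatorConst p hs hμs.ne c),
        Lp.coeFn_add (g ((v c).bochner t)) (g' ((v 0).bochner t)), hgs ((v c).bochner t),
        hgs' ((v 0).bochner t), (v c).coe_bochner t, (v 0).coe_bochner t,
        ae_window (hvf c) t, ae_window (hvf 0) t,
        indicatorConstLp_coeFn (p := p) (hs := hs) (hμs := hμs.ne) (c := c)]
        with θ h1 h2 h3 h4 h5 h6 h7 h8 h9
      rw [h1, h2, Pi.add_apply, h3, h4, Lp.simpleFunc.coe_indicatorConst, h9]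
      by_cases hθ : θ ∈ s
      · simp [hθ, h5, h7]
      · simp [hθ, h6, h8]
    simp only [heq]
    exact (((hv c).comp hg).prodMk ((hv 0).comp hg')).comp continuous_add
  | add hf hg hfg ihf ihg =>
    rename_i a b
    -- At every point one of the two functions vanishes, where it contributes `f(·, 0)`.
    have heq : ∀ t, windowMap hp N t (hf.toLp a + hg.toLp b) =
        windowMap hp N t (hf.toLp a) + windowMap hp N t (hg.toLp b) - (v 0).bochner t := fun t => by
      refine Lp.ext ?_
      filter_upwards [coe_windowMap hp hN t (hf.toLp a + hg.toLp b),
        coe_windowMap hp hN t (hf.toLp a), coe_windowMap hp hN t (hg.toLp b),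
        Lp.coeFn_add (hf.toLp a) (hg.toLp b), hf.coeFn_toLp, hg.coeFn_toLp,
        Lp.coeFn_sub (windowMap hp N t (hf.toLp a) + windowMap hp N t (hg.toLp b))
          ((v 0).bochner t),
        Lp.coeFn_add (windowMap hp N t (hf.toLp a)) (windowMap hp N t (hg.toLp b)),
        (v 0).coe_bochner t, ae_window (hvf 0) t] with θ h1 h2 h3 h4 h5 h6 h7 h8 h9 h10
      rw [h1, h7, Pi.sub_apply, h8, Pi.add_apply, h2, h3, h9, h10, h4, Pi.add_apply, h5, h6]
      by_cases ha : a θ = 0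
      · simp [ha]
      · have hb : b θ = 0 := by
          by_contra hb
          exact disjoint_left.1 hfg ha hb
        simp [hb]
    simp only [heq]
    exact ((ihf.prodMk ihg).prodMk (hv 0)).comp
      ((continuous_fst.fst.add continuous_fst.snd).sub continuous_snd)
  | isClosed => exact isClosed_setOf_almostAutomorphic (equicontinuous_windowMap hp hNc)

/-- The Nemytskii operator is defined on all of `L^p_loc`: on every window, `f(·, u(·))` agrees with
the value of the operator at a periodic function. In particular it is measurable, although no
Carathéodory condition is imposed on `f`. -/
theorem exists_nemytskii (hq : q ≠ ∞)
    (hN : ∀ u : Lp1 X p, ∀ᵐ t : ℝ, (N u).1 t = f t (u.1 t)) (u : LpLoc X p) :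
    ∃ v : LpLoc Y q, (∀ᵐ t : ℝ, v t = f t (u t)) ∧
      ∀ t, v.bochner t = windowMap hp N t (u.bochner t) := by
  have key : ∀ t, windowMap hp N t (u.bochner t) =ᵐ[volume.restrict (Ioo (0 : ℝ) 1)]
      fun θ => f (t + θ) (u (t + θ)) := fun t => by
    filter_upwards [coe_windowMap hp hN t (u.bochner t), u.coe_bochner t] with θ h1 h2
    rw [h1, h2]
  obtain ⟨v, hv⟩ := LpLoc.exists_of_memLp_window hq (g := fun s => f s (u s)) fun t =>
    (Lp.memLp _).ae_eq (key t)
  refine ⟨v, hv, fun t => Lp.ext ?_⟩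
  filter_upwards [key t, v.coe_bochner t, ae_window hv t] with θ h1 h2 h3
  rw [h1, h2, h3]

theorem nemytskiiContinuous_Saa [NormedSpace ℝ X] [CompleteSpace Y] (hp : p ≠ ∞) (hq : q ≠ ∞)
    (hf : ∀ x, ClassMem (fun t => f t x) (Saa Y q)) (hB : NemytskiiContinuous f (Lp1 X p) B) :
    NemytskiiContinuous f (Saa X p) (Saa Y q) := by
  obtain ⟨N, hN, hNc⟩ := hB
  have hequi := equicontinuous_windowMap hp hNc
  choose T hT hTb using exists_nemytskii hp hq hN
  have hTmem : ∀ u ∈ Saa X p, T u ∈ Saa Y q := fun u hu => by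
    have := AlmostAutomorphic.eval hequi (almostAutomorphic_windowMap hp hN hNc hf) hu
    rwa [← funext (hTb u)] at this
  refine ⟨fun u => ⟨T u.1, hTmem u.1 u.2⟩, fun u => hT u.1, EMetric.continuous_iff.2 ?_⟩
  intro u ε hε
  -- The range of `u.bochner` is relatively compact, so a single `δ` serves all windows.
  obtain ⟨η, hη, hηε⟩ := ENNReal.lt_iff_exists_nnreal_btwn.1 hε
  obtain ⟨δ, hδ, h⟩ := exists_uniform_modulus_of_isCompact hequi u.2.isCompact_closure_range
    (ε := η) (by exact_mod_cast hη)
  refine ⟨ENNReal.ofReal δ, ENNReal.ofReal_pos.2 hδ, fun v hv => lt_of_le_of_lt ?_ hηε⟩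
  refine iSup_le fun t => ?_
  rw [hTb, hTb, edist_comm, edist_dist, ← ENNReal.ofReal_coe_nnreal]
  refine ENNReal.ofReal_le_ofReal
    (h _ (subset_closure (mem_range_self t)) _ ?_ t).le
  rw [← ENNReal.ofReal_lt_ofReal_iff hδ, ← edist_dist, edist_comm]
  exact (LpLoc.edist_bochner_le v.1 u.1 t).trans_lt hv

end

section

variable {X Y : Type*} [NormedAddCommGroup X] [NormedAddCommGroup Y] {p q : ℝ≥0∞}
  [Fact (1 ≤ p)] [Fact (1 ≤ q)] {f : ℝ → X → Y}

theorem NemytskiiContinuous.mono_left {A A' : Set (LpLoc X p)} {B : Set (LpLoc Y q)}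
    (h : NemytskiiContinuous f A B) (hA : A' ⊆ A) : NemytskiiContinuous f A' B := by
  obtain ⟨N, hN, hNc⟩ := h
  exact ⟨fun u => N (inclusion hA u), fun u => hN (inclusion hA u),
    hNc.comp (continuous_inclusion hA)⟩

theorem NemytskiiContinuous.mono_right {A : Set (LpLoc X p)} {B B' : Set (LpLoc Y q)}
    (h : NemytskiiContinuous f A B) (hB : B ⊆ B') : NemytskiiContinuous f A B' := by
  obtain ⟨N, hN, hNc⟩ := h
  exact ⟨fun u => inclusion hB (N u), hN, (continuous_inclusion hB).comp hNc⟩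

/-- Constant functions are periodic. -/
theorem NemytskiiContinuous.classMem {B : Set (LpLoc Y q)}
    (h : NemytskiiContinuous f (Lp1 X p) B) (x : X) : ClassMem (fun t => f t x) B := by
  obtain ⟨N, hN, -⟩ := h
  have hx := AEEqFun.coeFn_const (μ := (volume : Measure ℝ)) (α := ℝ) x
  let c : LpLoc X p := ⟨AEEqFun.const ℝ x, fun a b =>
    (memLp_const x).ae_eq (ae_restrict_of_ae hx.symm)⟩
  have hc : ∀ᵐ t : ℝ, c t = x := hx
  have hmem : c ∈ Lp1 X p := by
    have h2 := (measurePreserving_add_right (volume : Measure ℝ) 1).quasiMeasurePreserving.ae hc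
    change ∀ᵐ t : ℝ, _
    filter_upwards [hc, h2] with t h1 h2
    rw [h1, h2]
  refine ⟨(N ⟨c, hmem⟩).1, (N ⟨c, hmem⟩).2, ?_⟩
  filter_upwards [hN ⟨c, hmem⟩, hc] with t h1 h2
  rw [h1, h2]

end
end Stepanov

theorem mainTheorem2 {X : Type*} {Y : Type*}
    [NormedAddCommGroup X] [NormedSpace ℝ X] [CompleteSpace X]
    [NormedAddCommGroup Y] [NormedSpace ℝ Y] [CompleteSpace Y]
    (p q : ℝ≥0∞) [Fact (1 ≤ p)] [Fact (1 ≤ q)] (hp : p ≠ ∞) (hq : q ≠ ∞)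
    (f : ℝ → X → Y) :
    List.TFAE [
      Stepanov.NemytskiiContinuous f (Stepanov.Saa X p) (Stepanov.Saa Y q),
      Stepanov.NemytskiiContinuous f (Stepanov.Lp1 X p) (Stepanov.Saa Y q),
      (∀ x : X, Stepanov.ClassMem (fun t => f t x) (Stepanov.Saa Y q)) ∧
        Stepanov.NemytskiiContinuous f (Stepanov.Lp1 X p) (Stepanov.BS Y q)] := by
  tfae_have 1 → 2 := fun h => h.mono_left (Stepanov.Lp1_subset_Saa hp)
  tfae_have 2 → 3 := fun h => ⟨h.classMem, h.mono_right Stepanov.Saa_subset_BS⟩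
  tfae_have 3 → 1 := fun h => Stepanov.nemytskiiContinuous_Saa hp hq h.1 h.2
  tfae_finish
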